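/- Let $X$ be a proper CAT(0) space with base point $x_0$, let $\partial X$ be its visual boundary and $\overline X=X\cup\partial X$ its visual bordification with the cone topology. For $\xi,\eta\in\partial X$ let $\angle(\xi,\eta)=\sup_{p\in X}\angle_p(\xi,\eta)$ be the angular metric, and let $Td(\xi,\eta)\in[0,\infty]$ be the Tits distance, that is, the length metric associated with $\angle$ (the infimum of the $\angle$-lengths of $\angle$-continuous paths from $\xi$ to $\eta$, and $\infty$ if there is no such path). For $A,B\subset\partial X$ put $Td(A,B)=\inf_{\xi\in A,\,\eta\in B}Td(\xi,\eta)$. An isometry of $X$ is a distance-preserving bijection $X\to X$; an isometry $g$ is unbounded if $\{g^n x_0: n>0\}$ is unbounded. We say that $g$ has limit points $\xi^-,\xi^+\in\partial X$ if there is a strictly increasing sequence of natural numbers $n_k$ such that $g^{n_k}x_0\to\xi^+$ and $g^{-n_k}x_0\to\xi^-$ in $\overline X$. Theorem. Let $g$ and $h$ be two unbounded isometries of $X$ with limit points $\xi^-,\xi^+$ and $\eta^-,\eta^+$ respectively (not necessarily all distinct). If $$Td(\{\xi^-,\xi^+\},\{\eta^-,\eta^+\})>\pi,$$ then the group generated by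 $g$ and $h$ contains a noncommutative free subgroup. -/

import Mathlib

open Filter Topology
open scoped NNReal ENNReal

noncomputable section

namespace CatZero

/-- The map `γ`, restricted to `[0, L]`, is a geodesic segment from `x` to `y`. -/
structure IsGeodesicSegment {X : Type*} [MetricSpace X] (γ : ℝ → X) (L : ℝ) (x y : X) : Prop where
  nonneg : 0 ≤ L
  source : γ 0 = x
  target : γ L = y
  isometric : ∀ s ∈ Set.Icc (0 : ℝ) L, ∀ t ∈ Set.Icc (0 : ℝ) L, dist (γ s) (γ t) = |s - t|

/-- CAT(0) spaces: geodesic metric spaces in which geodesic triangles are at least as thin as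
their comparison triangles `a' b' c'` in the Euclidean plane. The two points compared lie on two
sides issuing from a common vertex `a`; any vertex can play the role of `a`. The comparison point
of `γ s` on a side `[a, b]` of length `L` is the point of `[a', b']` at distance `s` from `a'`. -/
structure IsCATZero (X : Type*) [MetricSpace X] : Prop where
  geodesic : ∀ x y : X, ∃ (γ : ℝ → X) (L : ℝ), IsGeodesicSegment γ L x y
  thin : ∀ (a b c : X) (γ δ : ℝ → X) (L M : ℝ),
    IsGeodesicSegment γ L a b → IsGeodesicSegment δ M a c →
    ∀ a' b' c' : EuclideanSpace ℝ (Fin 2),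
      dist a' b' = dist a b → dist a' c' = dist a c → dist b' c' = dist b c →
      ∀ s ∈ Set.Icc (0 : ℝ) L, ∀ t ∈ Set.Icc (0 : ℝ) M,
        dist (γ s) (δ t) ≤
          dist (AffineMap.lineMap (k := ℝ) a' b' (s / L)) (AffineMap.lineMap (k := ℝ) a' c' (t / M))

/-- Geodesic rays, parametrized by arc length on `[0, ∞)`. -/
def GeodesicRay (X : Type*) [MetricSpace X] : Type _ := {c : ℝ≥0 → X // Isometry c}

instance {X : Type*} [MetricSpace X] : CoeFun (GeodesicRay X) (fun _ => ℝ≥0 → X) := ⟨Subtype.val⟩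

/-- Two rays are asymptotic if they stay at bounded distance from each other. -/
instance asymptotic (X : Type*) [MetricSpace X] : Setoid (GeodesicRay X) where
  r c c' := ∃ K : ℝ, ∀ t : ℝ≥0, dist (c t) (c' t) ≤ K
  iseqv :=
    { refl := fun _ => ⟨0, fun _ => (dist_self _).le⟩
      symm := fun ⟨K, hK⟩ => ⟨K, fun t => (dist_comm _ _).trans_le (hK t)⟩
      trans := fun ⟨K, hK⟩ ⟨M, hM⟩ =>
        ⟨K + M, fun t => (dist_triangle _ _ _).trans (add_le_add (hK t) (hM t))⟩ }

/-- The visual boundary `∂X`: asymptote classes of geodesic rays. -/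
def Boundary (X : Type*) [MetricSpace X] : Type _ := Quotient (asymptotic X)

/-- The endpoint `c(∞)` of a ray. -/
def GeodesicRay.endpoint {X : Type*} [MetricSpace X] (c : GeodesicRay X) : Boundary X :=
  Quotient.mk (asymptotic X) c

/-- The visual bordification `X ∪ ∂X`. -/
inductive Bordification (X : Type*) [MetricSpace X] : Type _
  | point (x : X) : Bordification X
  | ideal (ξ : Boundary X) : Bordification X

/-- The basic neighbourhood `U(c, r, ε)` of `c(∞)` in the bordification: the points `z`, at distance
more than `r` from `c(0)`, such that the point at distance `r` from `c(0)` on the segment or ray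
from `c(0)` to `z` is at distance less than `ε` from `c(r)`. -/
def coneNhd {X : Type*} [MetricSpace X] (c : GeodesicRay X) (r : ℝ≥0) (ε : ℝ) :
    Set (Bordification X) :=
  {z | match z with
    | .point x => (r : ℝ) < dist (c 0) x ∧ ∃ γ : ℝ → X,
        IsGeodesicSegment γ (dist (c 0) x) (c 0) x ∧ dist (γ r) (c r) < ε
    | .ideal ξ => ∃ c' : GeodesicRay X, c' 0 = c 0 ∧ c'.endpoint = ξ ∧ dist (c' r) (c r) < ε}

/-- The cone topology, generated by the open sets of `X` and the sets `U(c, r, ε)`. -/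
instance coneTopology (X : Type*) [MetricSpace X] : TopologicalSpace (Bordification X) :=
  TopologicalSpace.generateFrom
    ({U | ∃ V : Set X, IsOpen V ∧ U = Bordification.point '' V} ∪
      {U | ∃ (c : GeodesicRay X) (r : ℝ≥0) (ε : ℝ), 0 < r ∧ 0 < ε ∧ U = coneNhd c r ε})

/-- The angle at `p̄` of a Euclidean comparison triangle of `p`, `x`, `y` (for `x ≠ p ≠ y`). -/
def comparisonAngle {X : Type*} [MetricSpace X] (p x y : X) : ℝ :=
  Real.arccos ((dist p x ^ 2 + dist p y ^ 2 - dist x y ^ 2) / (2 * dist p x * dist p y))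

/-- The Alexandrov angle between two rays with the same origin. -/
def alexandrovAngle {X : Type*} [MetricSpace X] (c c' : GeodesicRay X) : ℝ :=
  limsup (fun q : ℝ≥0 × ℝ≥0 => comparisonAngle (c 0) (c q.1) (c' q.2))
    (𝓝[>] (0 : ℝ≥0) ×ˢ 𝓝[>] (0 : ℝ≥0))

/-- The angular metric `∠(ξ, η) = sup_p ∠_p(ξ, η)` on the boundary, where `∠_p(ξ, η)` is the angle
at `p` between the rays from `p` to `ξ` and to `η`. -/
def angularDist {X : Type*} [MetricSpace X] (ξ η : Boundary X) : ℝ :=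
  sSup {θ | ∃ c c' : GeodesicRay X, c 0 = c' 0 ∧ c.endpoint = ξ ∧ c'.endpoint = η ∧
    θ = alexandrovAngle c c'}

/-- Continuity of a path in the boundary with respect to the angular metric. -/
def AngularContinuous {X : Type*} [MetricSpace X] (γ : unitInterval → Boundary X) : Prop :=
  ∀ t : unitInterval, ∀ ε > 0, ∃ δ > 0, ∀ s : unitInterval, dist s t < δ →
    angularDist (γ s) (γ t) < ε

/-- Length of a path in the boundary with respect to the angular metric: the supremum, over finite
monotone sequences of parameters, of the sum of the successive angular distances. -/
def angularLength {X : Type*} [MetricSpace X] (γ : unitInterval → Boundary X) : ℝ≥0∞ :=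
  ⨆ p : ℕ × {u : ℕ → unitInterval // Monotone u},
    ∑ i ∈ Finset.range p.1, ENNReal.ofReal (angularDist (γ (p.2.1 i)) (γ (p.2.1 (i + 1))))

/-- The Tits metric: the length metric associated with the angular metric
(`∞` if there is no path). -/
def titsDist {X : Type*} [MetricSpace X] (ξ η : Boundary X) : ℝ≥0∞ :=
  ⨅ (γ : unitInterval → Boundary X) (_ : AngularContinuous γ ∧ γ 0 = ξ ∧ γ 1 = η), angularLength γ

/-- Tits distance between two sets of boundary points. -/
def titsSetDist {X : Type*} [MetricSpace X] (A B : Set (Boundary X)) : ℝ≥0∞ :=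
  ⨅ (ξ ∈ A) (η ∈ B), titsDist ξ η

/-- An isometry is unbounded if its forward orbit (of the base point `x₀`) is. -/
def IsUnbounded {X : Type*} [MetricSpace X] (x₀ : X) (g : X ≃ᵢ X) : Prop :=
  ¬ Bornology.IsBounded {x : X | ∃ n : ℕ, 0 < n ∧ x = (g ^ n) x₀}

/-- `ξm`, `ξp` are limit points `ξ⁻`, `ξ⁺` of `g`: along some subsequence of the iterates,
`g ^ (n k) x₀ → ξ⁺` and `g ^ (- n k) x₀ → ξ⁻`. -/
def HasLimitPoints {X : Type*} [MetricSpace X] (x₀ : X) (g : X ≃ᵢ X) (ξm ξp : Boundary X) : Prop :=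
  ∃ n : ℕ → ℕ, StrictMono n ∧
    Tendsto (fun k => Bordification.point ((g ^ n k) x₀)) atTop (𝓝 (Bordification.ideal ξp)) ∧
    Tendsto (fun k => Bordification.point ((g ^ n k)⁻¹ x₀)) atTop (𝓝 (Bordification.ideal ξm))

end CatZero

end

/-! Fix `p`. Comparison angles at `p` are superadditive when the opposite side is subdivided
(`comparisonAngle_add_le`), so a geodesic avoiding `p` sweeps a total comparison angle of at most
`π`. If geodesics between points tending to `ξ` and `η` leave every ball, the segments from `p` to
their points therefore converge to rays whose endpoints form a `π`-Lipschitz path for the angular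
metric, and `Td(ξ, η) ≤ π` (`titsDist_le_pi`). Conversely, when all Tits distances exceed `π`, every
geodesic from a neighbourhood `U` of `{ξ⁻, ξ⁺}` to a neighbourhood `V` of `{η⁻, η⁺}` crosses a fixed
ball around `p`.

Let `a` move `p` deep into `U`, and `a⁻¹` likewise. For `v ∈ V` the geodesic from `a⁻¹ p` to `v`
passes near `p`, so its image from `p` to `a v` passes near `a p`, and `a v ∈ U`
(`exists_biMoves_mapsTo`). Only a subsequence of the powers of `g` is controlled, so ping-pong
cannot use all of them. Instead take two powers `a`, `a'` of `g` such that `a⁻¹ a'` is also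
controlled, and similarly `b`, `b'` for `h`; then `a b⁻¹` and `a' b'⁻¹` are free generators
(`injective_lift_of_smul_mem`). -/

namespace CatZero

variable {X : Type*} [MetricSpace X]

/-! ### Geodesic segments and rays -/

namespace IsGeodesicSegment

variable {γ : ℝ → X} {L : ℝ} {x y : X}

lemma dist_source (h : IsGeodesicSegment γ L x y) {s : ℝ} (hs : s ∈ Set.Icc 0 L) :
    dist x (γ s) = s := by
  rw [← h.source, h.isometric 0 ⟨le_rfl, h.nonneg⟩ s hs, zero_sub, abs_neg, abs_of_nonneg hs.1]

lemma dist_eq (h : IsGeodesicSegment γ L x y) : dist x y = L := by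
  rw [← h.dist_source ⟨h.nonneg, le_rfl⟩, h.target]

lemma dist_target (h : IsGeodesicSegment γ L x y) {s : ℝ} (hs : s ∈ Set.Icc 0 L) :
    dist (γ s) y = L - s := by
  rw [← h.target, h.isometric s hs L ⟨h.nonneg, le_rfl⟩, abs_sub_comm,
    abs_of_nonneg (sub_nonneg.2 hs.2)]

lemma restrict (h : IsGeodesicSegment γ L x y) {s : ℝ} (hs : s ∈ Set.Icc 0 L) :
    IsGeodesicSegment γ s x (γ s) :=
  ⟨hs.1, h.source, rfl, fun a ha b hb =>
    h.isometric a ⟨ha.1, ha.2.trans hs.2⟩ b ⟨hb.1, hb.2.trans hs.2⟩⟩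

lemma reverse (h : IsGeodesicSegment γ L x y) : IsGeodesicSegment (fun s => γ (L - s)) L y x :=
  ⟨h.nonneg, by simp [h.target], by simp [h.source], fun a ha b hb => by
    rw [h.isometric (L - a) ⟨by linarith [ha.2], by linarith [ha.1]⟩ (L - b)
      ⟨by linarith [hb.2], by linarith [hb.1]⟩, abs_sub_comm]
    congr 1; ring⟩

lemma map (h : IsGeodesicSegment γ L x y) (g : X ≃ᵢ X) :
    IsGeodesicSegment (fun s => g (γ s)) L (g x) (g y) :=
  ⟨h.nonneg, by rw [h.source], by rw [h.target], fun a ha b hb => by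
    rw [g.isometry.dist_eq, h.isometric a ha b hb]⟩

lemma continuousOn (h : IsGeodesicSegment γ L x y) : ContinuousOn γ (Set.Icc 0 L) := by
  have : LipschitzOnWith 1 γ (Set.Icc 0 L) := LipschitzOnWith.of_dist_le_mul fun a ha b hb => by
    rw [h.isometric a ha b hb, NNReal.coe_one, one_mul, Real.dist_eq]
  exact this.continuousOn

end IsGeodesicSegment

lemma GeodesicRay.dist_eq (c : GeodesicRay X) (s t : ℝ≥0) : dist (c s) (c t) = |(s : ℝ) - t| := by
  rw [c.2.dist_eq, NNReal.dist_eq]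

lemma GeodesicRay.dist_zero (c : GeodesicRay X) (t : ℝ≥0) : dist (c 0) (c t) = t := by
  rw [c.dist_eq]; simp

lemma GeodesicRay.isGeodesicSegment (c : GeodesicRay X) (T : ℝ≥0) :
    IsGeodesicSegment (fun s => c s.toNNReal) T (c 0) (c T) :=
  ⟨T.2, by simp, by simp, fun a ha b hb => by
    rw [c.dist_eq, Real.coe_toNNReal _ ha.1, Real.coe_toNNReal _ hb.1]⟩

/-! ### The CAT(0) inequality and comparison angles -/

/-- The cosine of the comparison angle of two nontrivial sides. -/
lemma abs_comparison_cos_le_one {a b d : ℝ} (ha : 0 < a) (hb : 0 < b) (h1 : |a - b| ≤ d)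
    (h2 : d ≤ a + b) : |(a ^ 2 + b ^ 2 - d ^ 2) / (2 * a * b)| ≤ 1 := by
  have hd : 0 ≤ d := (abs_nonneg _).trans h1
  have h3 : (a - b) ^ 2 ≤ d ^ 2 := sq_le_sq' (by linarith [neg_abs_le (a - b)])
    ((le_abs_self _).trans h1)
  have h4 : d ^ 2 ≤ (a + b) ^ 2 := by gcongr
  rw [abs_le]
  constructor
  · rw [le_div_iff₀ (by positivity)]; nlinarith
  · rw [div_le_one (by positivity)]; nlinarith

lemma abs_dist_sub_dist_le (p x y : X) : |dist p x - dist p y| ≤ dist x y := by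
  rw [dist_comm p x, dist_comm p y]; exact abs_dist_sub_le x y p

/-- The CAT(0) inequality in algebraic form. -/
lemma IsCATZero.dist_sq_le (hX : IsCATZero X) {a b c : X} {γ δ : ℝ → X} {L M : ℝ}
    (hγ : IsGeodesicSegment γ L a b) (hδ : IsGeodesicSegment δ M a c) (hL : 0 < L) (hM : 0 < M)
    {s t : ℝ} (hs : s ∈ Set.Icc 0 L) (ht : t ∈ Set.Icc 0 M) :
    dist (γ s) (δ t) ^ 2 ≤
      s ^ 2 + t ^ 2 - s / L * (t / M) * (L ^ 2 + M ^ 2 - dist b c ^ 2) := by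
  have hab := hγ.dist_eq
  have hac := hδ.dist_eq
  obtain ⟨k, hk⟩ : ∃ k, k = (L ^ 2 + M ^ 2 - dist b c ^ 2) / (2 * L * M) := ⟨_, rfl⟩
  have hk1 : |k| ≤ 1 := by
    rw [hk, ← hab, ← hac]
    apply abs_comparison_cos_le_one (by linarith) (by linarith)
    · exact abs_dist_sub_dist_le a b c
    · rw [dist_comm a b]; exact dist_triangle b a c
  have hk2 : 0 ≤ 1 - k ^ 2 := by
    have := (sq_le_one_iff_abs_le_one k).2 hk1
    linarith
  have hkD : L ^ 2 + M ^ 2 - dist b c ^ 2 = 2 * L * M * k := by rw [hk]; field_simp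
  have hsq := Real.sq_sqrt hk2
  -- Comparison triangle with `a'` at the origin, `b'` on the first axis and angle of cosine `k` at
  -- `a'`.
  have key := hX.thin a b c γ δ L M hγ hδ 0 !₂[L, 0] !₂[M * k, M * Real.sqrt (1 - k ^ 2)]
    (by rw [hab]; simp [EuclideanSpace.dist_eq, Fin.sum_univ_two, Real.sqrt_sq hL.le])
    (by
      rw [hac, EuclideanSpace.dist_eq, Fin.sum_univ_two, ← Real.sqrt_sq hM.le]
      congr 1
      simp only [Real.dist_eq, sq_abs]
      simp
      rw [Real.sqrt_sq hM.le, mul_pow, mul_pow, hsq]; ring)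
    (by
      rw [EuclideanSpace.dist_eq, Fin.sum_univ_two, ← Real.sqrt_sq (dist_nonneg (x := b) (y := c))]
      congr 1
      simp only [Real.dist_eq, sq_abs]
      simp
      rw [mul_pow, hsq]; linarith)
    s hs t ht
  have h2 := pow_le_pow_left₀ dist_nonneg key 2
  refine h2.trans (le_of_eq ?_)
  rw [EuclideanSpace.dist_eq, Fin.sum_univ_two, Real.sq_sqrt (by positivity), hkD]
  simp only [Real.dist_eq, sq_abs, AffineMap.lineMap_apply]
  simp
  field_simp
  linear_combination t ^ 2 * hsq

/-- Comparison angles grow along two geodesics issuing from a common point. -/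
lemma IsCATZero.comparisonAngle_mono (hX : IsCATZero X) {a b c : X} {γ δ : ℝ → X} {L M : ℝ}
    (hγ : IsGeodesicSegment γ L a b) (hδ : IsGeodesicSegment δ M a c)
    {s t : ℝ} (hs0 : 0 < s) (hs : s ≤ L) (ht0 : 0 < t) (ht : t ≤ M) :
    comparisonAngle a (γ s) (δ t) ≤ comparisonAngle a b c := by
  have hL := hs0.trans_le hs
  have hM := ht0.trans_le ht
  have h := hX.dist_sq_le hγ hδ hL hM ⟨hs0.le, hs⟩ ⟨ht0.le, ht⟩
  unfold comparisonAngle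
  apply Real.arccos_le_arccos
  rw [hγ.dist_source ⟨hs0.le, hs⟩, hδ.dist_source ⟨ht0.le, ht⟩, hγ.dist_eq, hδ.dist_eq,
    div_le_div_iff₀ (by positivity) (by positivity)]
  have h3 : s / L * (t / M) * (L ^ 2 + M ^ 2 - dist b c ^ 2) * (2 * L * M) =
    (L ^ 2 + M ^ 2 - dist b c ^ 2) * (2 * s * t) := by field_simp
  nlinarith [mul_pos hL hM]

/-- Convexity: geodesics issuing from a common point diverge at least linearly. -/
lemma IsCATZero.dist_le_mul (hX : IsCATZero X) {a b c : X} {γ δ : ℝ → X} {L M : ℝ}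
    (hγ : IsGeodesicSegment γ L a b) (hδ : IsGeodesicSegment δ M a c) (hL : 0 < L) (hM : 0 < M)
    {u : ℝ} (hu0 : 0 ≤ u) (hu1 : u ≤ 1) :
    dist (γ (u * L)) (δ (u * M)) ≤ u * dist b c := by
  have h := hX.dist_sq_le hγ hδ hL hM (s := u * L) (t := u * M)
    ⟨by positivity, by nlinarith⟩ ⟨by positivity, by nlinarith⟩
  rw [mul_div_assoc, mul_div_assoc, div_self hL.ne', div_self hM.ne'] at h
  apply le_of_sq_le_sq _ (by positivity)
  nlinarith

lemma IsCATZero.dist_le_div_mul (hX : IsCATZero X) {a b c : X} {γ δ : ℝ → X} {L M : ℝ}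
    (hγ : IsGeodesicSegment γ L a b) (hδ : IsGeodesicSegment δ M a c)
    {t T : ℝ} (ht : 0 ≤ t) (htT : t ≤ T) (hT : 0 < T) (hTL : T ≤ L) (hTM : T ≤ M) :
    dist (γ t) (δ t) ≤ t / T * dist (γ T) (δ T) := by
  have h := hX.dist_le_mul (hγ.restrict ⟨hT.le, hTL⟩) (hδ.restrict ⟨hT.le, hTM⟩) hT hT
    (u := t / T) (by positivity) ((div_le_one hT).2 htT)
  rwa [div_mul_cancel₀ _ hT.ne'] at h

lemma comparisonAngle_nonneg (p x y : X) : 0 ≤ comparisonAngle p x y := Real.arccos_nonneg _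

lemma comparisonAngle_le_pi (p x y : X) : comparisonAngle p x y ≤ Real.pi := Real.arccos_le_pi _

lemma cos_comparisonAngle {p x y : X} (hx : 0 < dist p x) (hy : 0 < dist p y) :
    Real.cos (comparisonAngle p x y) =
      (dist p x ^ 2 + dist p y ^ 2 - dist x y ^ 2) / (2 * dist p x * dist p y) := by
  have h := abs_le.1 (abs_comparison_cos_le_one hx hy (abs_dist_sub_dist_le p x y)
    (by rw [dist_comm p x]; exact dist_triangle x p y))
  exact Real.cos_arccos h.1 h.2

lemma dist_sq_eq_comparisonAngle {p x y : X} (hx : 0 < dist p x) (hy : 0 < dist p y) :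
    dist x y ^ 2 = dist p x ^ 2 + dist p y ^ 2 -
      2 * dist p x * dist p y * Real.cos (comparisonAngle p x y) := by
  rw [cos_comparisonAngle hx hy]; field_simp; ring

lemma tendsto_comparisonAngle {ι : Type*} {l : Filter ι} {p x y : X} {u v : ι → X}
    (hu : Tendsto u l (𝓝 x)) (hv : Tendsto v l (𝓝 y)) (hx : 0 < dist p x) (hy : 0 < dist p y) :
    Tendsto (fun i => comparisonAngle p (u i) (v i)) l (𝓝 (comparisonAngle p x y)) := by
  have h1 : Tendsto (fun i => dist p (u i)) l (𝓝 (dist p x)) := tendsto_const_nhds.dist hu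
  have h2 : Tendsto (fun i => dist p (v i)) l (𝓝 (dist p y)) := tendsto_const_nhds.dist hv
  have h3 : Tendsto (fun i => dist (u i) (v i)) l (𝓝 (dist x y)) := hu.dist hv
  exact (Real.continuous_arccos.tendsto _).comp
    ((((h1.pow 2).add (h2.pow 2)).sub (h3.pow 2)).div ((h1.const_mul 2).mul h2) (by positivity))

lemma comparisonAngle_self {p x : X} (hx : 0 < dist p x) : comparisonAngle p x x = 0 := by
  unfold comparisonAngle
  rw [dist_self, Real.arccos_eq_zero]
  apply le_of_eq
  field_simp
  ring

/-! ### Superadditivity of comparison angles -/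

/-- Side lengths `a, r, b` from a vertex and `l₁, l₂` across: the cosines at the vertex of the two
triangles sharing the side `r` have nonnegative sum if the middle point is below the chord. -/
lemma cos_add_cos_nonneg {a b r l₁ l₂ : ℝ} (ha : 0 < a) (hb : 0 < b) (hr : 0 < r) (h₁ : 0 < l₁)
    (h₂ : 0 < l₂) (ht₁ : |a - l₁| ≤ r) (ht₂ : |b - l₂| ≤ r)
    (h : (l₁ + l₂) * r ^ 2 ≤ l₂ * a ^ 2 + l₁ * b ^ 2 - l₁ * l₂ * (l₁ + l₂)) :
    0 ≤ (a ^ 2 + r ^ 2 - l₁ ^ 2) / (2 * a * r) + (r ^ 2 + b ^ 2 - l₂ ^ 2) / (2 * r * b) := by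
  -- Two angles of a Euclidean triangle add up to at most `π`, so the cosine of one is at least
  -- minus that of the other. This moves the question to the foot of the side `r`, where `h`, of
  -- Stewart type, says that the two angles add up to at least `π`.
  have key : ∀ a l : ℝ, 0 < a → 0 < l → |a - l| ≤ r →
      -((r ^ 2 + l ^ 2 - a ^ 2) / (2 * r * l)) ≤ (a ^ 2 + r ^ 2 - l ^ 2) / (2 * a * r) := by
    intro a l ha hl hal
    rw [← sub_nonneg, sub_neg_eq_add]
    have : (a ^ 2 + r ^ 2 - l ^ 2) / (2 * a * r) + (r ^ 2 + l ^ 2 - a ^ 2) / (2 * r * l) =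
        (a + l) * (r ^ 2 - |a - l| ^ 2) / (2 * r * a * l) := by
      rw [sq_abs]; field_simp; ring
    rw [this]
    have := pow_le_pow_left₀ (abs_nonneg _) hal 2
    have : 0 ≤ r ^ 2 - |a - l| ^ 2 := by linarith
    positivity
  have k₁ := key a l₁ ha h₁ ht₁
  have k₂ := key b l₂ hb h₂ ht₂
  have k₃ : (r ^ 2 + l₁ ^ 2 - a ^ 2) / (2 * r * l₁) + (r ^ 2 + l₂ ^ 2 - b ^ 2) / (2 * r * l₂) ≤ 0 := by
    rw [div_add_div _ _ (by positivity) (by positivity)]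
    apply div_nonpos_of_nonpos_of_nonneg _ (by positivity)
    nlinarith
  have : (r ^ 2 + b ^ 2 - l₂ ^ 2) / (2 * r * b) = (b ^ 2 + r ^ 2 - l₂ ^ 2) / (2 * b * r) := by
    congr 1 <;> ring
  linarith

/-- Comparison angles are superadditive under subdivision of the opposite side. -/
lemma IsCATZero.comparisonAngle_add_le (hX : IsCATZero X) {p x y : X} {σ : ℝ → X} {L : ℝ}
    (hσ : IsGeodesicSegment σ L x y) {s : ℝ} (hs : s ∈ Set.Icc 0 L) (hx : 0 < dist p x)
    (hy : 0 < dist p y) (hq : 0 < dist p (σ s)) :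
    comparisonAngle p x (σ s) + comparisonAngle p (σ s) y ≤ comparisonAngle p x y := by
  rcases hs.1.eq_or_lt with h0 | h0
  · rw [← h0, hσ.source, comparisonAngle_self hx, zero_add]
  rcases hs.2.eq_or_lt with hL | hL
  · rw [hL, hσ.target, comparisonAngle_self hy, add_zero]
  have d₁ := hσ.dist_source hs
  have d₂ := hσ.dist_target hs
  have d₃ := hσ.dist_eq
  have c₁ := dist_sq_eq_comparisonAngle hx hq
  have c₂ := dist_sq_eq_comparisonAngle hq hy
  have c₃ := dist_sq_eq_comparisonAngle hx hy
  have e₁ := cos_comparisonAngle hx hq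
  have e₂ := cos_comparisonAngle hq hy
  have n₁ := comparisonAngle_nonneg p x (σ s)
  have n₂ := comparisonAngle_nonneg p (σ s) y
  have n₃ := comparisonAngle_nonneg p x y
  have m₂ := comparisonAngle_le_pi p (σ s) y
  have m₁ := comparisonAngle_le_pi p x (σ s)
  have m₃ := comparisonAngle_le_pi p x y
  obtain ⟨τ, M, hτ⟩ := hX.geodesic x p
  have hM := hτ.dist_eq
  rw [dist_comm] at hM
  have cat := hX.dist_sq_le hσ hτ (h0.trans hL) (hM ▸ hx) hs ⟨hτ.nonneg, le_rfl⟩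
  have t₁ := abs_dist_sub_dist_le x p (σ s)
  have t₂ := abs_dist_sub_dist_le y p (σ s)
  rw [dist_comm x p, d₁] at t₁
  rw [dist_comm y p, dist_comm y (σ s), d₂] at t₂
  rw [hτ.target, div_self (hM ▸ hx).ne', mul_one, dist_comm (σ s) p, dist_comm y p, ← hM] at cat
  have hcat : (s + (L - s)) * dist p (σ s) ^ 2 ≤
      (L - s) * dist p x ^ 2 + s * dist p y ^ 2 - s * (L - s) * (s + (L - s)) := by
    have hLp := h0.trans hL
    have := mul_le_mul_of_nonneg_left cat hLp.le
    have e : L * (s ^ 2 + dist p x ^ 2 - s / L * (L ^ 2 + dist p x ^ 2 - dist p y ^ 2)) =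
      L * s ^ 2 + L * dist p x ^ 2 - s * (L ^ 2 + dist p x ^ 2 - dist p y ^ 2) := by
      field_simp
    rw [e] at this
    nlinarith
  have hcos := cos_add_cos_nonneg hx hy hq h0 (sub_pos.2 hL) t₁ t₂ hcat
  rw [d₁] at e₁ c₁
  rw [d₂] at e₂ c₂
  rw [d₃] at c₃
  rw [← e₁, ← e₂] at hcos
  generalize comparisonAngle p x (σ s) = α at *
  generalize comparisonAngle p (σ s) y = β at *
  generalize comparisonAngle p x y = θ at *
  -- Ensures that `α + β` lies in `[0, π]`, where the cosine is decreasing.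
  have hαβ : α ≤ Real.pi - β := by
    rw [← Real.strictAntiOn_cos.le_iff_ge (a := Real.pi - β) (b := α)
      ⟨by linarith, by linarith⟩ ⟨n₁, m₁⟩, Real.cos_pi_sub]
    linarith
  rw [← Real.strictAntiOn_cos.le_iff_ge (a := θ) (b := α + β) ⟨n₃, m₃⟩
    ⟨by linarith, by linarith⟩, Real.cos_add]
  have s₁ := Real.sin_sq_add_cos_sq α
  have s₂ := Real.sin_sq_add_cos_sq β
  generalize Real.cos α = ca at *
  generalize Real.cos β = cb at *
  generalize Real.sin α = sa at *
  generalize Real.sin β = sb at *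
  generalize Real.cos θ = ct at *
  generalize dist p x = a at *
  generalize dist p y = b at *
  generalize dist p (σ s) = r at *
  -- Glue the two comparison triangles in the plane along `[p, q]`, with `p = 0` and `q = (r, 0)`.
  -- This is Cauchy–Schwarz for `x - q` and `y - q`, of lengths `s` and `L - s`; hence the glued `x`
  -- and `y` are at distance at most `L`.
  have hsq : (a * sa) * (b * sb) - (a * ca - r) * (b * cb - r) ≤ s * (L - s) := by
    apply le_of_sq_le_sq _ (mul_nonneg h0.le (sub_pos.2 hL).le)
    have f₁ : s ^ 2 = (a * ca - r) ^ 2 + (a * sa) ^ 2 := by linear_combination c₁ + a ^ 2 * (-s₁)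
    have f₂ : (L - s) ^ 2 = (b * cb - r) ^ 2 + (b * sb) ^ 2 := by
      linear_combination c₂ + b ^ 2 * (-s₂)
    rw [mul_pow s, f₁, f₂]
    linarith [sq_nonneg ((a * ca - r) * (b * sb) + (a * sa) * (b * cb - r))]
  have hfin : a * b * ct ≤ a * b * (ca * cb - sa * sb) := by nlinarith
  exact le_of_mul_le_mul_left hfin (mul_pos hx hy)

/-- Along a geodesic avoiding `p`, the comparison angle at `p` between two points is at most the
difference of their comparison angles with the starting point. -/
lemma IsCATZero.comparisonAngle_le_sub (hX : IsCATZero X) {p x y : X} {σ : ℝ → X} {L : ℝ}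
    (hσ : IsGeodesicSegment σ L x y) (hp : ∀ s ∈ Set.Icc 0 L, 0 < dist p (σ s)) {s t : ℝ}
    (hs : 0 ≤ s) (hst : s ≤ t) (ht : t ≤ L) :
    comparisonAngle p (σ s) (σ t) ≤ comparisonAngle p x (σ t) - comparisonAngle p x (σ s) := by
  have h0 := hp 0 ⟨le_rfl, hσ.nonneg⟩
  rw [hσ.source] at h0
  have := hX.comparisonAngle_add_le (hσ.restrict ⟨hs.trans hst, ht⟩) ⟨hs, hst⟩ h0
    (hp t ⟨hs.trans hst, ht⟩) (hp s ⟨hs, hst.trans ht⟩)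
  linarith

/-- A geodesic avoiding `p` can be reparametrized by `[0, 1]` so as to be `π`-Lipschitz for
comparison angles at `p`. -/
lemma IsCATZero.exists_reparametrization (hX : IsCATZero X) {p x y : X} {σ : ℝ → X} {L : ℝ}
    (hσ : IsGeodesicSegment σ L x y) (hp : ∀ s ∈ Set.Icc 0 L, 0 < dist p (σ s)) :
    ∃ s : unitInterval → ℝ, (∀ u, s u ∈ Set.Icc 0 L) ∧ s 0 = 0 ∧ s 1 = L ∧
      ∀ u v : unitInterval, u ≤ v →
        comparisonAngle p (σ (s u)) (σ (s v)) ≤ Real.pi * ((v : ℝ) - u) := by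
  have hx : 0 < dist p x := by simpa [hσ.source] using hp 0 ⟨le_rfl, hσ.nonneg⟩
  set f : ℝ → ℝ := fun s => comparisonAngle p x (σ s) with hf
  have hcont : ContinuousOn f (Set.Icc 0 L) := fun s hs =>
    tendsto_comparisonAngle tendsto_const_nhds (hσ.continuousOn s hs) hx (hp s hs)
  have hf0 : f 0 = 0 := by simp only [hf, hσ.source, comparisonAngle_self hx]
  have hmono : ∀ s t, 0 ≤ s → s ≤ t → t ≤ L → comparisonAngle p (σ s) (σ t) ≤ f t - f s :=
    fun s t hs hst ht => hX.comparisonAngle_le_sub hσ hp hs hst ht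
  have hfL : f L ≤ Real.pi := comparisonAngle_le_pi _ _ _
  have hfL0 : 0 ≤ f L := comparisonAngle_nonneg _ _ _
  have hivt : ∀ u : unitInterval, ∃ s ∈ Set.Icc 0 L, f s = u * f L := fun u => by
    have := intermediate_value_Icc hσ.nonneg hcont
    rw [hf0] at this
    exact this ⟨mul_nonneg u.2.1 hfL0, mul_le_of_le_one_left hfL0 u.2.2⟩
  choose s hs hfs using hivt
  classical
  -- The values at `0` and `1` are prescribed because `f` need not be injective, so a chosen
  -- preimage could miss the ends.
  refine ⟨fun u => if u = 0 then 0 else if u = 1 then L else s u, ?_, by simp, by simp, ?_⟩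
  · intro u
    dsimp only
    split_ifs
    exacts [⟨le_rfl, hσ.nonneg⟩, ⟨hσ.nonneg, le_rfl⟩, hs u]
  · have hval : ∀ u : unitInterval,
        (if u = 0 then 0 else if u = 1 then L else s u) ∈ Set.Icc 0 L ∧
        f (if u = 0 then 0 else if u = 1 then L else s u) = u * f L := fun u => by
      split_ifs with h0 h1
      · exact ⟨⟨le_rfl, hσ.nonneg⟩, by simp [h0, hf0]⟩
      · exact ⟨⟨hσ.nonneg, le_rfl⟩, by simp [h1]⟩
      · exact ⟨hs u, hfs u⟩
    intro u v huv
    dsimp only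
    obtain ⟨hu, hfu⟩ := hval u
    obtain ⟨hv, hfv⟩ := hval v
    generalize (if u = 0 then 0 else if u = 1 then L else s u) = a at *
    generalize (if v = 0 then 0 else if v = 1 then L else s v) = b at *
    have huv' : (u : ℝ) ≤ v := huv
    have hbound : (v - u : ℝ) * f L ≤ Real.pi * (v - u) := by
      rw [mul_comm]; exact mul_le_mul_of_nonneg_right hfL (by linarith)
    rcases le_total a b with hab | hab
    · refine (hmono a b hu.1 hab hv.2).trans ?_
      rw [hfu, hfv]; linarith
    -- If the chosen parameters are in the wrong order, the bound is `(u - v) * f L ≤ 0`.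
    · have h := hmono b a hv.1 hab hu.2
      have hcomm : comparisonAngle p (σ a) (σ b) = comparisonAngle p (σ b) (σ a) := by
        unfold comparisonAngle
        rw [dist_comm (σ a), add_comm, mul_right_comm]
      rw [hcomm]
      rw [hfu, hfv] at h
      nlinarith [mul_nonneg (sub_nonneg.2 huv') hfL0, mul_nonneg (sub_nonneg.2 huv') Real.pi_pos.le]

/-! ### Rays, their endpoints and the angular metric -/

/-- An upper bound for the comparison angles along two rays with the same origin bounds the angular
distance of their endpoints. -/
lemma IsCATZero.angularDist_le (hX : IsCATZero X) {c c' : GeodesicRay X} (h0 : c 0 = c' 0) {B : ℝ}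
    (hB0 : 0 ≤ B) (hBpi : B ≤ Real.pi)
    (h : ∀ T : ℝ≥0, 0 < T → comparisonAngle (c 0) (c T) (c' T) ≤ B) :
    angularDist c.endpoint c'.endpoint ≤ B := by
  apply Real.sSup_le _ hB0
  rintro _ ⟨e, e', he0, he, he', rfl⟩
  obtain ⟨K, hK⟩ := Quotient.exact he
  obtain ⟨K', hK'⟩ := Quotient.exact he'
  have hmono : ∀ T : ℝ≥0, 0 < T → alexandrovAngle e e' ≤ comparisonAngle (e 0) (e T) (e' T) := by
    intro T hT
    apply limsup_le_of_le
    · exact isCoboundedUnder_le_of_le _ (x := 0) fun _ => comparisonAngle_nonneg _ _ _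
    · have hev : ∀ᶠ s : ℝ≥0 in 𝓝[>] 0, s ∈ Set.Ioc 0 T := Ioc_mem_nhdsGT hT
      filter_upwards [hev.prod_mk hev] with q hq
      have := hX.comparisonAngle_mono (e.isGeodesicSegment T) (he0 ▸ e'.isGeodesicSegment T)
        (s := q.1) (t := q.2) hq.1.1 hq.1.2 hq.2.1 hq.2.2
      simpa using this
  -- The chord of an arc `B` of the unit circle. Changing the origin alters `dist (c T) (c' T) ≤ κ *
  -- T` by at most `K + K'`, which is negligible after division by `T`.
  set κ := Real.sqrt (2 - 2 * Real.cos B) with hκ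
  have hκ2 : κ ^ 2 = 2 - 2 * Real.cos B := Real.sq_sqrt (by linarith [Real.cos_le_one B])
  have hdist : ∀ T : ℝ≥0, 0 < T → dist (c T) (c' T) ≤ κ * T := by
    intro T hT
    have hT' : (0 : ℝ) < T := hT
    apply le_of_sq_le_sq _ (by positivity)
    have d₁ := c.dist_zero T
    have d₂ := c'.dist_zero T
    rw [← h0] at d₂
    rw [dist_sq_eq_comparisonAngle (p := c 0) (by rw [d₁]; exact hT) (by rw [d₂]; exact hT), d₁, d₂,
      mul_pow, hκ2]
    have := Real.cos_le_cos_of_nonneg_of_le_pi (comparisonAngle_nonneg _ _ _) hBpi (h T hT)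
    nlinarith [mul_le_mul_of_nonneg_left this (sq_nonneg (T : ℝ))]
  have hbound : ∀ T : ℝ≥0, 0 < T →
      alexandrovAngle e e' ≤ Real.arccos (1 - (κ + (K + K') * (T : ℝ)⁻¹) ^ 2 / 2) := by
    intro T hT
    have hT' : (0 : ℝ) < T := hT
    refine (hmono T hT).trans ?_
    unfold comparisonAngle
    apply Real.arccos_le_arccos
    have d₁ := e.dist_zero T
    have d₂ := e'.dist_zero T
    rw [← he0] at d₂
    have d₃ : dist (e T) (e' T) ≤ κ * T + (K + K') := by
      have := dist_triangle4 (e T) (c T) (c' T) (e' T)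
      have := hK T
      have := hK' T
      rw [dist_comm] at this
      linarith [hdist T hT]
    rw [d₁, d₂, le_div_iff₀ (by positivity)]
    have d₄ : κ + (K + K') * (T : ℝ)⁻¹ = (κ * T + (K + K')) / T := by field_simp
    have := pow_le_pow_left₀ dist_nonneg d₃ 2
    rw [d₄, div_pow]
    field_simp
    linarith
  have hlim : Tendsto (fun T : ℝ≥0 => Real.arccos (1 - (κ + (K + K') * (T : ℝ)⁻¹) ^ 2 / 2)) atTop
      (𝓝 (Real.arccos (1 - (κ + (K + K') * 0) ^ 2 / 2))) := by
    have hinv : Tendsto (fun T : ℝ≥0 => (T : ℝ)⁻¹) atTop (𝓝 0) :=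
      tendsto_inv_atTop_zero.comp (NNReal.tendsto_coe_atTop.2 tendsto_id)
    exact (Real.continuous_arccos.tendsto _).comp
      (((((hinv.const_mul _).const_add κ).pow 2).div_const 2).const_sub 1)
  have hval : Real.arccos (1 - (κ + (K + K') * 0) ^ 2 / 2) = B := by
    rw [mul_zero, add_zero, hκ2, ← Real.arccos_cos hB0 hBpi]
    congr 1
    rw [Real.arccos_cos hB0 hBpi]; ring
  rw [hval] at hlim
  exact ge_of_tendsto hlim ((eventually_gt_atTop 0).mono hbound)

/-- In a proper space, geodesics of lengths tending to infinity from a common origin converge along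
an ultrafilter to a ray. -/
lemma exists_limit_ray [ProperSpace X] {p : X} {ρ : ℕ → ℝ → X} {L : ℕ → ℝ} {q : ℕ → X}
    (hρ : ∀ n, IsGeodesicSegment (ρ n) (L n) p (q n)) (hL : Tendsto L atTop atTop) :
    ∃ e : GeodesicRay X, e 0 = p ∧
      ∀ t : ℝ≥0, Tendsto (fun n => ρ n t) (hyperfilter ℕ : Filter ℕ) (𝓝 (e t)) := by
  have hle : (hyperfilter ℕ : Filter ℕ) ≤ atTop := Nat.hyperfilter_le_atTop
  have hmem : ∀ t : ℝ≥0, ∀ᶠ n in (hyperfilter ℕ : Filter ℕ), (t : ℝ) ∈ Set.Icc 0 (L n) := fun t =>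
    hle ((hL.eventually_ge_atTop (t : ℝ)).mono fun n hn => ⟨t.2, hn⟩)
  -- A single ultrafilter handles all `t` at once, with no diagonal extraction.
  have hlim : ∀ t : ℝ≥0, ∃ z, Tendsto (fun n => ρ n t) (hyperfilter ℕ : Filter ℕ) (𝓝 z) := by
    intro t
    have hball : ∀ᶠ n in (hyperfilter ℕ : Filter ℕ), ρ n t ∈ Metric.closedBall p t := by
      filter_upwards [hmem t] with n hn
      rw [Metric.mem_closedBall, dist_comm, (hρ n).dist_source hn]
    obtain ⟨z, -, hz⟩ := (isCompact_closedBall p (t : ℝ)).ultrafilter_le_nhds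
      ((hyperfilter ℕ).map fun n => ρ n t) (by rw [le_principal_iff]; exact hball)
    exact ⟨z, hz⟩
  choose e he using hlim
  have hiso : Isometry e := Isometry.of_dist_eq fun s t => by
    refine tendsto_nhds_unique ((he s).dist (he t)) (tendsto_const_nhds.congr' ?_)
    filter_upwards [hmem s, hmem t] with n hs ht
    rw [(hρ n).isometric _ hs _ ht, NNReal.dist_eq]
  refine ⟨⟨e, hiso⟩, tendsto_nhds_unique (he 0) (tendsto_const_nhds.congr fun n => ?_), he⟩
  rw [NNReal.coe_zero, (hρ n).source]

/-- Every boundary point is the endpoint of a ray issuing from a given point. -/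
lemma IsCATZero.exists_ray [ProperSpace X] (hX : IsCATZero X) (p : X) (ξ : Boundary X) :
    ∃ c : GeodesicRay X, c 0 = p ∧ c.endpoint = ξ := by
  obtain ⟨c, rfl⟩ := Quotient.exists_rep ξ
  choose ρ L hρ using fun n : ℕ => hX.geodesic p (c n)
  have hLd : ∀ n, |L n - n| ≤ dist p (c 0) := fun n => by
    have h := abs_dist_sub_le p (c 0) (c n)
    rwa [(hρ n).dist_eq, c.dist_zero, NNReal.coe_natCast] at h
  have hL : Tendsto L atTop atTop := by
    refine tendsto_atTop_mono (fun n => ?_)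
      (tendsto_atTop_add_const_right _ (-dist p (c 0)) tendsto_natCast_atTop_atTop)
    have := (abs_le.1 (hLd n)).1
    linarith
  obtain ⟨e, he0, he⟩ := exists_limit_ray hρ hL
  refine ⟨e, he0, Quotient.sound ⟨2 * dist p (c 0), fun t => ?_⟩⟩
  refine le_of_tendsto ((he t).dist tendsto_const_nhds) (Nat.hyperfilter_le_atTop ?_)
  filter_upwards [hL.eventually_ge_atTop (t : ℝ), hL.eventually_gt_atTop 0, eventually_gt_atTop 0]
    with n hn hn0 hn1
  have hn1' : (0 : ℝ) < n := by exact_mod_cast hn1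
  -- Convexity is applied from the common end `c n`, both geodesics being run backwards. The point
  -- at distance `t` from `p` is matched with parameter `t / L n * n` on `c`; correcting this to `t`
  -- costs a second `dist p (c 0)`.
  have h := hX.dist_le_mul (hρ n).reverse (c.isGeodesicSegment n).reverse hn0
    (by simpa using hn1) (u := 1 - t / L n) (by rw [sub_nonneg, div_le_one hn0]; exact hn)
    (by rw [sub_le_self_iff]; positivity)
  have e₁ : L n - (1 - t / L n) * L n = t := by field_simp; ring
  have e₂ : ((n : ℝ≥0) : ℝ) - (1 - t / L n) * ((n : ℝ≥0) : ℝ) = t / L n * n := by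
    rw [NNReal.coe_natCast]; ring
  simp only [e₁, e₂] at h
  have hd0 := dist_nonneg (x := p) (y := c 0)
  have h₁ : dist (ρ n t) (c (t / L n * n).toNNReal) ≤ dist p (c 0) := by
    refine h.trans (mul_le_of_le_one_left hd0 ?_)
    rw [sub_le_self_iff]; positivity
  have h₂ : dist (c (t / L n * n).toNNReal) (c t) ≤ dist p (c 0) := by
    rw [c.dist_eq, Real.coe_toNNReal _ (by positivity)]
    have : t / L n * n - t = t / L n * (n - L n) := by field_simp
    rw [this, abs_mul, abs_of_nonneg (by positivity : (0 : ℝ) ≤ t / L n), abs_sub_comm]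
    exact (mul_le_of_le_one_left (abs_nonneg _) ((div_le_one hn0).2 hn)).trans (hLd n)
  linarith [dist_triangle (ρ n t) (c (t / L n * n).toNNReal) (c t)]

/-! ### Escaping geodesics and Tits distance -/

/-- A `K`-Lipschitz path for the angular metric bounds the Tits distance of its ends. -/
lemma titsDist_le_of_lipschitz {γ : unitInterval → Boundary X} {K : ℝ} (hK : 0 < K)
    (h : ∀ u v : unitInterval, angularDist (γ u) (γ v) ≤ K * |(u : ℝ) - v|) :
    titsDist (γ 0) (γ 1) ≤ ENNReal.ofReal K := by
  refine iInf₂_le_of_le γ ⟨fun t ε hε => ⟨ε / K, by positivity, fun s hs => ?_⟩, rfl, rfl⟩ ?_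
  · refine (h s t).trans_lt ?_
    rw [Subtype.dist_eq, Real.dist_eq, lt_div_iff₀ hK] at hs
    linarith
  · refine iSup_le fun ⟨n, u, hu⟩ => ?_
    have hterm : ∀ i, ENNReal.ofReal (angularDist (γ (u i)) (γ (u (i + 1)))) ≤
        ENNReal.ofReal (K * (u (i + 1) - u i)) := fun i => by
      apply ENNReal.ofReal_le_ofReal
      have hi : (u i : ℝ) ≤ u (i + 1) := hu i.le_succ
      rw [← abs_of_nonneg (sub_nonneg.2 hi), abs_sub_comm]
      exact h _ _
    refine (Finset.sum_le_sum fun i _ => hterm i).trans ?_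
    rw [← ENNReal.ofReal_sum_of_nonneg fun i _ => mul_nonneg hK.le (sub_nonneg.2 (hu i.le_succ)),
      ← Finset.mul_sum, Finset.sum_range_sub (fun i => (u i : ℝ))]
    apply ENNReal.ofReal_le_ofReal
    have := (u n).2.2
    have := (u 0).2.1
    nlinarith

/-- If geodesic segments, whose endpoints converge to two boundary points, leave every ball, then
these boundary points have Tits distance at most `π`. -/
lemma IsCATZero.titsDist_le_pi [ProperSpace X] (hX : IsCATZero X) {p : X} {c c' : GeodesicRay X}
    {x y : ℕ → X} {α β σ : ℕ → ℝ → X} {L M N : ℕ → ℝ}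
    (hα : ∀ n, IsGeodesicSegment (α n) (M n) p (x n))
    (hβ : ∀ n, IsGeodesicSegment (β n) (N n) p (y n))
    (hσ : ∀ n, IsGeodesicSegment (σ n) (L n) (x n) (y n))
    (hc : ∀ (n : ℕ) (t : ℝ≥0), t ≤ n → dist (α n t) (c t) ≤ 1)
    (hc' : ∀ (n : ℕ) (t : ℝ≥0), t ≤ n → dist (β n t) (c' t) ≤ 1)
    (hesc : ∀ n, ∀ s ∈ Set.Icc 0 (L n), (n : ℝ) < dist p (σ n s)) :
    titsDist c.endpoint c'.endpoint ≤ ENNReal.ofReal Real.pi := by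
  have hpos : ∀ n, ∀ s ∈ Set.Icc 0 (L n), 0 < dist p (σ n s) := fun n s hs =>
    (Nat.cast_nonneg n).trans_lt (hesc n s hs)
  choose s hs hs0 hs1 hang using fun n => hX.exists_reparametrization (hσ n) (hpos n)
  -- Using `α n` and `β n` themselves at the two ends lets `hc` and `hc'` identify the endpoints of
  -- the limit rays.
  have hseg : ∀ (u : unitInterval) (n : ℕ), ∃ (ρ : ℝ → X) (R : ℝ),
      IsGeodesicSegment ρ R p (σ n (s n u)) ∧ (u = 0 → ρ = α n) ∧ (u = 1 → ρ = β n) := by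
    intro u n
    rcases eq_or_ne u 0 with rfl | h0
    · exact ⟨α n, M n, by rw [hs0, (hσ n).source]; exact hα n, fun _ => rfl, fun h => by simp at h⟩
    rcases eq_or_ne u 1 with rfl | h1
    · exact ⟨β n, N n, by rw [hs1, (hσ n).target]; exact hβ n, fun h => by simp at h, fun _ => rfl⟩
    obtain ⟨ρ, R, h⟩ := hX.geodesic p (σ n (s n u))
    exact ⟨ρ, R, h, fun h => (h0 h).elim, fun h => (h1 h).elim⟩
  choose ρ R hρ hρ0 hρ1 using hseg
  have hR : ∀ u (n : ℕ), (n : ℝ) < R u n := fun u n => by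
    rw [← (hρ u n).dist_eq]; exact hesc n _ (hs n u)
  have hRt : ∀ u, Tendsto (R u) atTop atTop := fun u =>
    tendsto_atTop_mono (fun n => (hR u n).le) tendsto_natCast_atTop_atTop
  choose e he0 he using fun u => exists_limit_ray (hρ u) (hRt u)
  have hend : ∀ (u : unitInterval) (d : GeodesicRay X),
      (∀ (n : ℕ) (t : ℝ≥0), t ≤ n → dist (ρ u n t) (d t) ≤ 1) → (e u).endpoint = d.endpoint := by
    refine fun u d hd => Quotient.sound ⟨1, fun t => ?_⟩
    refine le_of_tendsto ((he u t).dist tendsto_const_nhds) (Nat.hyperfilter_le_atTop ?_)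
    obtain ⟨m, hm⟩ := exists_nat_ge t
    filter_upwards [eventually_ge_atTop m] with n hn
    exact hd n t (hm.trans (by exact_mod_cast hn))
  have h0 : (e 0).endpoint = c.endpoint := hend 0 c fun n t ht => by
    rw [hρ0 0 n rfl]; exact hc n t ht
  have h1 : (e 1).endpoint = c'.endpoint := hend 1 c' fun n t ht => by
    rw [hρ1 1 n rfl]; exact hc' n t ht
  rw [← h0, ← h1]
  have hle : ∀ u v : unitInterval, u ≤ v →
      ∀ T : ℝ≥0, 0 < T → comparisonAngle p (e u T) (e v T) ≤ Real.pi * ((v : ℝ) - u) := by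
    intro u v huv T hT
    have hdT : ∀ u, 0 < dist p (e u T) := fun u => by
      have := (e u).dist_zero T
      rw [he0] at this
      rw [this]; exact hT
    refine le_of_tendsto (tendsto_comparisonAngle (he u T) (he v T) (hdT u) (hdT v))
      (Nat.hyperfilter_le_atTop ?_)
    filter_upwards [(hRt u).eventually_ge_atTop (T : ℝ), (hRt v).eventually_ge_atTop (T : ℝ)]
      with n hu hv
    -- At fixed `T` the angle is at most the one seen at the far points on `σ n`, a bound that
    -- survives the limit.
    exact (hX.comparisonAngle_mono (hρ u n) (hρ v n) hT hu hT hv).trans (hang n u v huv)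
  have hcomm : ∀ x y : X, comparisonAngle p x y = comparisonAngle p y x := fun x y => by
    unfold comparisonAngle
    rw [dist_comm x, add_comm, mul_right_comm]
  refine titsDist_le_of_lipschitz (γ := fun u => (e u).endpoint) Real.pi_pos fun u v => ?_
  have huv1 : |(u : ℝ) - v| ≤ 1 := abs_sub_le_iff.2
    ⟨by linarith [u.2.2, v.2.1], by linarith [v.2.2, u.2.1]⟩
  refine hX.angularDist_le (by rw [he0, he0]) (mul_nonneg Real.pi_pos.le (abs_nonneg _))
    (mul_le_of_le_one_right Real.pi_pos.le huv1) fun T hT => ?_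
  rw [he0]
  rcases le_total u v with huv | huv
  · rw [abs_sub_comm, abs_of_nonneg (sub_nonneg.2 (Subtype.coe_le_coe.2 huv))]
    exact hle u v huv T hT
  · rw [abs_of_nonneg (sub_nonneg.2 (Subtype.coe_le_coe.2 huv)), hcomm]
    exact hle v u huv T hT

/-! ### Visual neighbourhoods and shadows -/

/-- The points of `X` in the basic neighbourhood `U(c, r, 1)` of the endpoint of a ray. -/
def visualNhd (c : GeodesicRay X) (r : ℝ≥0) : Set X := {x | Bordification.point x ∈ coneNhd c r 1}

lemma lt_dist_of_mem_visualNhd {c : GeodesicRay X} {r : ℝ≥0} {x : X} (hx : x ∈ visualNhd c r) :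
    (r : ℝ) < dist (c 0) x := hx.1

/-- Geodesics are unique in a CAT(0) space, so the existential in `coneNhd` can be tested on any one
of them. -/
lemma IsCATZero.mem_visualNhd_iff (hX : IsCATZero X) {c : GeodesicRay X} {r : ℝ≥0} {x : X}
    {γ : ℝ → X} {L : ℝ} (hγ : IsGeodesicSegment γ L (c 0) x) :
    x ∈ visualNhd c r ↔ (r : ℝ) < L ∧ dist (γ r) (c r) < 1 := by
  obtain rfl := hγ.dist_eq
  refine ⟨fun ⟨hr, γ', hγ', h⟩ => ⟨hr, ?_⟩, fun ⟨hr, h⟩ => ⟨hr, γ, hγ, h⟩⟩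
  have hpos := r.2.trans_lt hr
  have := hX.dist_le_mul hγ hγ' hpos hpos (u := r / dist (c 0) x) (by positivity)
    ((div_le_one hpos).2 hr.le)
  rw [dist_self, mul_zero, div_mul_cancel₀ _ hpos.ne'] at this
  linarith [dist_triangle (γ r) (γ' r) (c r)]

lemma IsCATZero.dist_le_of_mem_visualNhd (hX : IsCATZero X) {c : GeodesicRay X} {r t : ℝ≥0} {x : X}
    {γ : ℝ → X} {L : ℝ} (hγ : IsGeodesicSegment γ L (c 0) x) (hx : x ∈ visualNhd c r)
    (hr : 0 < r) (ht : t ≤ r) : dist (γ t) (c t) ≤ t / r * dist (γ r) (c r) := by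
  have h := hX.dist_le_div_mul hγ (c.isGeodesicSegment r) t.coe_nonneg (NNReal.coe_le_coe.2 ht)
    (NNReal.coe_pos.2 hr) ((hX.mem_visualNhd_iff hγ).1 hx).1.le le_rfl
  simpa using h

lemma IsCATZero.dist_le_one_of_mem_visualNhd (hX : IsCATZero X) {c : GeodesicRay X} {r t : ℝ≥0}
    {x : X} {γ : ℝ → X} {L : ℝ} (hγ : IsGeodesicSegment γ L (c 0) x) (hx : x ∈ visualNhd c r)
    (ht : t ≤ r) : dist (γ t) (c t) ≤ 1 := by
  have h1 := ((hX.mem_visualNhd_iff hγ).1 hx).2.le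
  rcases ht.eq_or_lt with rfl | hlt
  · exact h1
  have hr := zero_le.trans_lt hlt
  refine (hX.dist_le_of_mem_visualNhd hγ hx hr ht).trans (mul_le_one₀ ?_ dist_nonneg h1)
  exact (div_le_one (NNReal.coe_pos.2 hr)).2 (NNReal.coe_le_coe.2 ht)

lemma IsCATZero.visualNhd_anti (hX : IsCATZero X) (c : GeodesicRay X) {r r' : ℝ≥0} (h : r ≤ r') :
    visualNhd c r' ⊆ visualNhd c r := by
  intro x hx
  obtain ⟨γ, L, hγ⟩ := hX.geodesic (c 0) x
  obtain ⟨h₁, h₂⟩ := (hX.mem_visualNhd_iff hγ).1 hx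
  rw [hX.mem_visualNhd_iff hγ]
  refine ⟨(NNReal.coe_le_coe.2 h).trans_lt h₁, ?_⟩
  rcases h.eq_or_lt with rfl | hlt
  · exact h₂
  have hr' : (0 : ℝ) < r' := NNReal.coe_pos.2 (zero_le.trans_lt hlt)
  refine (hX.dist_le_of_mem_visualNhd hγ hx hr' h).trans_lt ?_
  refine mul_lt_one_of_nonneg_of_lt_one_left (by positivity) ?_ h₂.le
  exact (div_lt_one hr').2 hlt

/-- Shadows: a geodesic from the origin of the ray `c` passing near a point deep in the
neighbourhoods of `c(∞)` ends near `c(∞)`. -/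
lemma IsCATZero.exists_visualNhd_shadow (hX : IsCATZero X) {R : ℝ≥0} (hR : 1 ≤ R) :
    ∃ r : ℝ≥0, R ≤ r ∧ ∀ (c : GeodesicRay X), ∀ z ∈ visualNhd c r, ∀ (w : X) (σ : ℝ → X) (L : ℝ),
      IsGeodesicSegment σ L (c 0) w → ∀ s ∈ Set.Icc 0 L, dist (σ s) z ≤ R → w ∈ visualNhd c R := by
  have hR0 : (1 : ℝ) ≤ R := hR
  -- With this depth `m > 7 * R ^ 2 + R`, so the two errors at radius `R` are at most `R / m * 3R ≤
  -- 3/7` and `R / r ≤ 1/2`, together less than `1`.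
  refine ⟨7 * R ^ 2 + 2 * R, ?_, ?_⟩
  · rw [← NNReal.coe_le_coe]; push_cast; nlinarith
  intro c z hz w σ L hσ s hs hsz
  obtain ⟨γ, D, hγ⟩ := hX.geodesic (c 0) z
  have hD := ((hX.mem_visualNhd_iff hγ).1 hz).1
  have hRD : R ≤ 7 * R ^ 2 + 2 * R := by
    rw [← NNReal.coe_le_coe]; push_cast; nlinarith
  have hcR := hX.dist_le_of_mem_visualNhd hγ hz ((zero_lt_one.trans_le hR).trans_le hRD) hRD
  have hcr := hX.dist_le_one_of_mem_visualNhd hγ hz le_rfl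
  set r : ℝ := ((7 * R ^ 2 + 2 * R : ℝ≥0) : ℝ) with hr
  have hr' : r = 7 * (R : ℝ) ^ 2 + 2 * R := by rw [hr]; push_cast; rfl
  have hr0 : 0 < r := by rw [hr']; positivity
  have hsD : |s - D| ≤ R := by
    have := abs_dist_sub_dist_le (c 0) (σ s) z
    rw [hσ.dist_source hs, hγ.dist_eq] at this
    exact this.trans hsz
  obtain ⟨hsD₁, hsD₂⟩ := abs_le.1 hsD
  -- A parameter available on both geodesics and within `R` of both `s` and `D`.
  obtain ⟨m, hm⟩ : ∃ m, m = min s D := ⟨_, rfl⟩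
  have hms : m ≤ s := hm ▸ min_le_left _ _
  have hmD : m ≤ D := hm ▸ min_le_right _ _
  have hmR : 7 * (R : ℝ) ^ 2 + R < m := by
    rw [hm, lt_min_iff]; constructor <;> nlinarith
  have hm0 : 0 < m := by nlinarith
  have hRm : (R : ℝ) ≤ m := by nlinarith
  have hdm : dist (σ m) (γ m) ≤ 3 * R := by
    have h₁ : dist (σ m) (σ s) ≤ R := by
      rw [hσ.isometric m ⟨hm0.le, hms.trans hs.2⟩ s hs, abs_sub_comm,
        abs_of_nonneg (sub_nonneg.2 hms)]
      rcases le_total s D with h | h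
      · rw [hm, min_eq_left h, sub_self]; exact R.2
      · rw [hm, min_eq_right h]; exact hsD₂
    have h₂ : dist z (γ m) ≤ R := by
      rw [dist_comm, hγ.dist_target ⟨hm0.le, hmD⟩]
      rcases le_total s D with h | h
      · rw [hm, min_eq_left h]; linarith
      · rw [hm, min_eq_right h, sub_self]; exact R.2
    linarith [dist_triangle4 (σ m) (σ s) z (γ m)]
  rw [hX.mem_visualNhd_iff hσ]
  refine ⟨?_, ?_⟩
  · have := hs.2
    nlinarith
  have h₃ := hX.dist_le_div_mul hσ hγ R.coe_nonneg hRm hm0 (hms.trans hs.2) hmD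
  have h₄ : (R : ℝ) / m * dist (σ m) (γ m) ≤ 3 / 7 := by
    rw [div_mul_eq_mul_div, div_le_iff₀ hm0]
    nlinarith
  have h₅ : (R : ℝ) / r * dist (γ r) (c (7 * R ^ 2 + 2 * R)) ≤ 1 / 2 := by
    rw [div_mul_eq_mul_div, div_le_iff₀ hr0]
    nlinarith
  have := dist_triangle (σ R) (γ R) (c R)
  linarith

/-! ### Geodesics forced through a ball -/

/-- If two boundary points have Tits distance greater than `π`, then all geodesics between points
near them pass through a fixed ball. -/
lemma IsCATZero.exists_forall_geodesic_near [ProperSpace X] (hX : IsCATZero X) {p : X}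
    {c c' : GeodesicRay X} (hc : c 0 = p) (hc' : c' 0 = p)
    (hT : ENNReal.ofReal Real.pi < titsDist c.endpoint c'.endpoint) :
    ∃ R : ℕ, ∀ x ∈ visualNhd c R, ∀ y ∈ visualNhd c' R, ∀ (σ : ℝ → X) (L : ℝ),
      IsGeodesicSegment σ L x y → ∃ s ∈ Set.Icc 0 L, dist p (σ s) ≤ R := by
  by_contra! hcon
  choose x hx y hy σ L hσ hesc using hcon
  choose α M hα using fun n => hX.geodesic p (x n)
  choose β N hβ using fun n => hX.geodesic p (y n)
  refine hT.not_ge (hX.titsDist_le_pi hα hβ hσ (fun n t ht => ?_) (fun n t ht => ?_) hesc)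
  · exact hX.dist_le_one_of_mem_visualNhd (by rw [hc]; exact hα n) (hx n) ht
  · exact hX.dist_le_one_of_mem_visualNhd (by rw [hc']; exact hβ n) (hy n) ht

/-- Every geodesic from `U` to `V` meets the closed ball of radius `R` around `p`. -/
def GeodesicsNear (p : X) (R : ℝ) (U V : Set X) : Prop :=
  ∀ x ∈ U, ∀ y ∈ V, ∀ (σ : ℝ → X) (L : ℝ), IsGeodesicSegment σ L x y →
    ∃ s ∈ Set.Icc 0 L, dist p (σ s) ≤ R

lemma GeodesicsNear.symm {p : X} {R : ℝ} {U V : Set X} (h : GeodesicsNear p R U V) :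
    GeodesicsNear p R V U := fun x hx y hy σ L hσ => by
  obtain ⟨s, hs, hd⟩ := h y hy x hx _ L hσ.reverse
  exact ⟨L - s, ⟨by linarith [hs.2], by linarith [hs.1]⟩, hd⟩

/-- The union of the neighbourhoods `U(c, r, 1)` over a family of rays. -/
def visualNhds {ι : Type*} (c : ι → GeodesicRay X) (r : ℝ≥0) : Set X := ⋃ i, visualNhd (c i) r

lemma IsCATZero.visualNhds_anti (hX : IsCATZero X) {ι : Type*} (c : ι → GeodesicRay X) {r r' : ℝ≥0}
    (h : r ≤ r') : visualNhds c r' ⊆ visualNhds c r :=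
  Set.iUnion_mono fun i => hX.visualNhd_anti (c i) h

lemma IsCATZero.exists_geodesicsNear [ProperSpace X] (hX : IsCATZero X) {p : X} {ι : Type*}
    [Finite ι] {c d : ι → GeodesicRay X} (hc : ∀ i, c i 0 = p) (hd : ∀ i, d i 0 = p)
    (hT : ∀ i j, ENNReal.ofReal Real.pi < titsDist (c i).endpoint (d j).endpoint) :
    ∃ R : ℝ≥0, 1 ≤ R ∧ GeodesicsNear p R (visualNhds c R) (visualNhds d R) := by
  choose R hR using fun k : ι × ι => hX.exists_forall_geodesic_near (hc k.1) (hd k.2) (hT k.1 k.2)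
  obtain ⟨S, hS⟩ := Finite.exists_le R
  -- The `+ 1` provides `1 ≤ R`, which the shadow lemma needs.
  refine ⟨S + 1, le_add_self, fun x hx y hy σ L hσ => ?_⟩
  obtain ⟨i, hi⟩ := Set.mem_iUnion.1 hx
  obtain ⟨j, hj⟩ := Set.mem_iUnion.1 hy
  have hle : (R (i, j) : ℝ≥0) ≤ S + 1 := by exact_mod_cast (hS (i, j)).trans S.le_succ
  obtain ⟨s, hs, h⟩ := hR (i, j) x (hX.visualNhd_anti _ hle hi) y (hX.visualNhd_anti _ hle hj) σ L hσ
  exact ⟨s, hs, h.trans (by exact_mod_cast hle)⟩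

/-- A common point would be a constant geodesic meeting the ball of radius `R`, whereas the
neighbourhoods lie outside that ball. -/
lemma disjoint_visualNhds {p : X} {ι : Type*} {c d : ι → GeodesicRay X}
    (hc : ∀ i, c i 0 = p) {R : ℝ≥0} (h : GeodesicsNear p R (visualNhds c R) (visualNhds d R)) :
    Disjoint (visualNhds c R) (visualNhds d R) := by
  rw [Set.disjoint_left]
  intro x hx hx'
  obtain ⟨s, -, hs⟩ := h x hx x hx' (fun _ => x) 0
    ⟨le_rfl, rfl, rfl, fun s hs t ht => by
      rw [le_antisymm hs.2 hs.1, le_antisymm ht.2 ht.1]; simp⟩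
  obtain ⟨i, hi⟩ := Set.mem_iUnion.1 hx
  have := lt_dist_of_mem_visualNhd hi
  rw [hc] at this
  exact this.not_ge hs

/-! ### Dynamics of isometries near their limit points -/

/-- The isometries moving `p` into `U` together with their inverses. -/
def biMoves (p : X) (U : Set X) : Set (X ≃ᵢ X) := {a | a p ∈ U ∧ a⁻¹ p ∈ U}

lemma inv_mem_biMoves {p : X} {U : Set X} {a : X ≃ᵢ X} (ha : a ∈ biMoves p U) :
    a⁻¹ ∈ biMoves p U := ⟨ha.2, by rw [inv_inv]; exact ha.1⟩

/-- The geodesic from `a⁻¹ p` to `v` passes within `R` of `p`; its image under `a` starts at `p` and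
passes within `R` of `a p`, so the shadow lemma places `a v`. The depth `r` depends only on `R`,
hence serves both families of rays. -/
lemma IsCATZero.exists_biMoves_mapsTo (hX : IsCATZero X) {p : X} {R : ℝ≥0} (hR : 1 ≤ R) :
    ∃ r : ℝ≥0, R ≤ r ∧ ∀ (c : Bool → GeodesicRay X), (∀ i, c i 0 = p) → ∀ V : Set X,
      GeodesicsNear p R (visualNhds c R) V →
        ∀ a ∈ biMoves p (visualNhds c r), Set.MapsTo a V (visualNhds c R) := by
  obtain ⟨r, hr, hsh⟩ := hX.exists_visualNhd_shadow hR
  refine ⟨r, hr, fun c hc V hV a ha v hv => ?_⟩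
  obtain ⟨i, hi⟩ := Set.mem_iUnion.1 ha.1
  obtain ⟨σ, L, hσ⟩ := hX.geodesic (a⁻¹ p) v
  obtain ⟨s, hs, hd⟩ := hV _ (hX.visualNhds_anti c hr ha.2) v hv σ L hσ
  have hσ' := hσ.map a
  rw [IsometryEquiv.apply_inv_self] at hσ'
  refine Set.mem_iUnion.2 ⟨i, hsh (c i) _ hi _ _ L (by rw [hc]; exact hσ') s hs ?_⟩
  rw [a.isometry.dist_eq, dist_comm]
  exact hd

lemma eventually_mem_visualNhd {c : GeodesicRay X} {r : ℝ≥0} (hr : 0 < r) {x : ℕ → X}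
    (h : Tendsto (fun k => Bordification.point (x k)) atTop (𝓝 (Bordification.ideal c.endpoint))) :
    ∀ᶠ k in atTop, x k ∈ visualNhd c r := by
  have hopen : IsOpen (coneNhd c r 1) :=
    TopologicalSpace.isOpen_generateFrom_of_mem (Or.inr ⟨c, r, 1, hr, zero_lt_one, rfl⟩)
  have hmem : Bordification.ideal c.endpoint ∈ coneNhd c r 1 :=
    ⟨c, rfl, rfl, by rw [dist_self]; exact zero_lt_one⟩
  exact h.eventually_mem (hopen.mem_nhds hmem)

/-- Powers of `g` along a sequence converging to limit points stay in neighbourhoods of the limit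
points, even after division by a fixed power. -/
lemma IsCATZero.exists_biMoves_powers (hX : IsCATZero X) {p : X} {g : X ≃ᵢ X}
    {c : Bool → GeodesicRay X}
    (hg : HasLimitPoints p g (c false).endpoint (c true).endpoint) {r : ℝ≥0} (hr : 1 ≤ r) :
    ∃ a ∈ Subgroup.zpowers g, ∃ b ∈ Subgroup.zpowers g, a ∈ biMoves p (visualNhds c r) ∧
      b ∈ biMoves p (visualNhds c r) ∧ a⁻¹ * b ∈ biMoves p (visualNhds c r) := by
  obtain ⟨n, -, hp, hm⟩ := hg
  have hev : ∀ r : ℝ≥0, 0 < r → ∃ k,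
      (g ^ n k) p ∈ visualNhd (c true) r ∧ (g ^ n k)⁻¹ p ∈ visualNhd (c false) r := fun r hr =>
    ((eventually_mem_visualNhd hr hp).and (eventually_mem_visualNhd hr hm)).exists
  obtain ⟨k, hk₁, hk₂⟩ := hev r (zero_lt_one.trans_le hr)
  set a := g ^ n k
  -- As `a` and `b` will commute, `a⁻¹ b p = b a⁻¹ p` is as far from `b p` as `a⁻¹ p` is from `p`.
  -- So `b` is chosen after `a`, deep enough to absorb an error `K`.
  obtain ⟨K, hrK, hK₁, hK₂⟩ : ∃ K : ℝ≥0, r ≤ K ∧ nndist (a⁻¹ p) p ≤ K ∧ nndist (a p) p ≤ K :=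
    ⟨r ⊔ (nndist (a⁻¹ p) p ⊔ nndist (a p) p), le_sup_left, le_sup_left.trans le_sup_right,
      le_sup_right.trans le_sup_right⟩
  obtain ⟨r', hKr', hsh⟩ := hX.exists_visualNhd_shadow (hr.trans hrK)
  have hnear : ∀ i, ∀ z ∈ visualNhd (c i) r', ∀ w, dist w z ≤ K → w ∈ visualNhd (c i) r := by
    intro i z hz w hwz
    obtain ⟨σ, L, hσ⟩ := hX.geodesic (c i 0) w
    exact hX.visualNhd_anti _ hrK (hsh (c i) z hz w σ L hσ L ⟨hσ.nonneg, le_rfl⟩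
      (by rw [hσ.target]; exact hwz))
  obtain ⟨l, hl₁, hl₂⟩ := hev r' ((zero_lt_one.trans_le (hr.trans hrK)).trans_le hKr')
  set b := g ^ n l
  have hab : Commute a b := (Commute.refl g).pow_pow _ _
  have hrr' := hrK.trans hKr'
  refine ⟨a, Subgroup.npow_mem_zpowers g _, b, Subgroup.npow_mem_zpowers g _,
    ⟨Set.mem_iUnion.2 ⟨true, hk₁⟩, Set.mem_iUnion.2 ⟨false, hk₂⟩⟩,
    ⟨Set.mem_iUnion.2 ⟨true, hX.visualNhd_anti _ hrr' hl₁⟩,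
      Set.mem_iUnion.2 ⟨false, hX.visualNhd_anti _ hrr' hl₂⟩⟩,
    Set.mem_iUnion.2 ⟨true, hnear _ _ hl₁ _ ?_⟩, Set.mem_iUnion.2 ⟨false, hnear _ _ hl₂ _ ?_⟩⟩
  · rw [hab.inv_left.eq, IsometryEquiv.mul_apply, b.isometry.dist_eq]
    exact hK₁
  · rw [mul_inv_rev, inv_inv, IsometryEquiv.mul_apply, b⁻¹.isometry.dist_eq]
    exact hK₂

/-! ### Ping-pong -/

/-- Ping-pong on words: each letter maps every set of the table, except that of the inverse letter,
into its own set. -/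
lemma prod_smul_subset {G α ι : Type*} [Group G] [MulAction G α] {a : ι → G}
    {P : ι × Bool → Set α}
    (hP : ∀ l j : ι × Bool, j ≠ (l.1, !l.2) → ∀ z ∈ P j, cond l.2 (a l.1) (a l.1)⁻¹ • z ∈ P l) :
    ∀ (L : List (ι × Bool)) (l : ι × Bool), FreeGroup.IsReduced (l :: L) →
      ∃ k : ι × Bool, ∀ j ≠ k, ∀ z ∈ P j,
        ((l :: L).map fun x => cond x.2 (a x.1) (a x.1)⁻¹).prod • z ∈ P l
  -- The only excluded set is that of the inverse of the last letter of the word, the first to act.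
  | [], l, _ => ⟨(l.1, !l.2), fun j hj z hz => by simpa using hP l j hj z hz⟩
  | l' :: L, l, h => by
    rw [FreeGroup.isReduced_cons_cons] at h
    obtain ⟨k, hk⟩ := prod_smul_subset hP L l' h.2
    refine ⟨k, fun j hj z hz => ?_⟩
    rw [List.map_cons, List.prod_cons, mul_smul]
    refine hP l l' (fun e => ?_) _ (hk j hj z hz)
    have := h.1 (by rw [e])
    rw [e] at this
    simp at this

/-- A ping-pong criterion for two elements to generate a free group. -/
lemma injective_lift_of_table {G α : Type*} [Group G] [MulAction G α] {a : Bool → G}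
    {P : Bool × Bool → Set α} (hne : ∀ l, (P l).Nonempty) (hd : Pairwise (Function.onFun Disjoint P))
    (hP : ∀ l j : Bool × Bool, j ≠ (l.1, !l.2) → ∀ z ∈ P j, cond l.2 (a l.1) (a l.1)⁻¹ • z ∈ P l) :
    Function.Injective (FreeGroup.lift a) := by
  rw [injective_iff_map_eq_one]
  intro w hw
  rw [← FreeGroup.toWord_eq_nil_iff]
  have hred := FreeGroup.isReduced_toWord (x := w)
  rw [← FreeGroup.mk_toWord (x := w), FreeGroup.lift_mk] at hw
  cases hL : w.toWord with
  | nil => rfl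
  | cons l L =>
    rw [hL] at hred hw
    obtain ⟨k, hk⟩ := prod_smul_subset hP L l hred
    -- Among four sets one is neither excluded nor the target; a trivial word would fix its points
    -- yet move them into `P l`.
    obtain ⟨j, hjk, hjl⟩ : ∃ j, j ≠ k ∧ j ≠ l :=
      (by decide : ∀ k l : Bool × Bool, ∃ j, j ≠ k ∧ j ≠ l) k l
    obtain ⟨z, hz⟩ := hne j
    have := hk j hjk z hz
    rw [hw, one_smul] at this
    exact (Set.disjoint_left.1 (hd hjl) hz this).elim

/-- Ping-pong with incomplete information on powers: if `a i`, `(a i)⁻¹`, `(a i)⁻¹ * a j` for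
`i ≠ j` map `V` into `U`, and likewise for `b` with `U` and `V` exchanged, then the elements
`a i * (b i)⁻¹` generate a free group. -/
lemma injective_lift_of_smul_mem {G α : Type*} [Group G] [MulAction G α] {U V : Set α}
    (hUV : Disjoint U V) (hU : U.Nonempty) (hV : V.Nonempty) {a b : Bool → G}
    (ha : ∀ i, ∀ z ∈ V, a i • z ∈ U) (hai : ∀ i, ∀ z ∈ V, (a i)⁻¹ • z ∈ U)
    (haa : ∀ i j, i ≠ j → ∀ z ∈ V, ((a i)⁻¹ * a j) • z ∈ U)
    (hb : ∀ i, ∀ z ∈ U, b i • z ∈ V) (hbi : ∀ i, ∀ z ∈ U, (b i)⁻¹ • z ∈ V)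
    (hbb : ∀ i j, i ≠ j → ∀ z ∈ U, ((b i)⁻¹ * b j) • z ∈ V) :
    Function.Injective (FreeGroup.lift fun i => a i * (b i)⁻¹) := by
  have hA : ∀ i, (a i • ·) '' V ⊆ U := fun i => Set.image_subset_iff.2 (ha i)
  have hB : ∀ i, (b i • ·) '' U ⊆ V := fun i => Set.image_subset_iff.2 (hb i)
  -- The table is `a i V ⊆ U`, `b i U ⊆ V`. The letter `a i * (b i)⁻¹` excludes only `b i U`: `(b
  -- i)⁻¹` sends the other three sets into `V`. The quotient hypotheses also separate `a i V` from
  -- `a j V`, and `b i U` from `b j U`.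
  refine injective_lift_of_table
    (P := fun l => cond l.2 ((a l.1 • ·) '' V) ((b l.1 • ·) '' U)) ?_ ?_ ?_
  · rintro ⟨i, _ | _⟩
    exacts [hU.image _, hV.image _]
  · rintro ⟨i, _ | _⟩ ⟨j, _ | _⟩ hij
    · refine Set.disjoint_left.2 ?_
      rintro _ ⟨u, hu, rfl⟩ ⟨u', hu', h⟩
      have := hbb i j (fun e => hij (by rw [e])) u' hu'
      rw [mul_smul] at this
      simp only at h
      rw [h, inv_smul_smul] at this
      exact Set.disjoint_left.1 hUV hu this
    · exact hUV.symm.mono (hB i) (hA j)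
    · exact hUV.mono (hA i) (hB j)
    · refine Set.disjoint_left.2 ?_
      rintro _ ⟨v, hv, rfl⟩ ⟨v', hv', h⟩
      have := haa i j (fun e => hij (by rw [e])) v' hv'
      rw [mul_smul] at this
      simp only at h
      rw [h, inv_smul_smul] at this
      exact Set.disjoint_left.1 hUV this hv
  · rintro ⟨i, _ | _⟩ ⟨j, _ | _⟩ hij z hz
    · refine ⟨(a i)⁻¹ • z, hai i z (hB j hz), ?_⟩
      simp [mul_smul]
    · obtain ⟨v, hv, rfl⟩ := hz
      refine ⟨((a i)⁻¹ * a j) • v, haa i j (fun e => hij (by simp [e])) v hv, ?_⟩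
      simp [mul_smul]
    · obtain ⟨u, hu, rfl⟩ := hz
      refine ⟨((b i)⁻¹ * b j) • u, hbb i j (fun e => hij (by simp [e])) u hu, ?_⟩
      simp [mul_smul]
    · refine ⟨(b i)⁻¹ • z, hbi i z (hA j hz), ?_⟩
      simp [mul_smul]

/-- A subgroup containing free generators `a true`, `a false` has a noncommutative free subgroup. -/
lemma exists_isFreeGroup_of_injective_lift {G : Type*} [Group G] {K : Subgroup G} {a : Bool → G}
    (ha : ∀ i, a i ∈ K) (hinj : Function.Injective (FreeGroup.lift a)) :
    ∃ H : Subgroup G, H ≤ K ∧ IsFreeGroup H ∧ ∃ x ∈ H, ∃ y ∈ H, x * y ≠ y * x := by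
  refine ⟨(FreeGroup.lift a).range, ?_, IsFreeGroup.ofMulEquiv (MonoidHom.ofInjective hinj),
    _, ⟨FreeGroup.of true, rfl⟩, _, ⟨FreeGroup.of false, rfl⟩, ?_⟩
  · rw [FreeGroup.range_lift_eq_closure, Subgroup.closure_le]
    rintro _ ⟨i, rfl⟩
    exact ha i
  · rw [← map_mul, ← map_mul]
    exact hinj.ne (by decide)

/-! ### The main theorem -/

/-- The action of the isometry group. -/
@[reducible] def isometryAction (X : Type*) [MetricSpace X] : MulAction (X ≃ᵢ X) X where
  smul g x := g x
  one_smul _ := rfl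
  mul_smul _ _ _ := rfl

end CatZero

theorem mainTheorem7 {X : Type*} [MetricSpace X] [ProperSpace X] (hX : CatZero.IsCATZero X)
    (x₀ : X) (g h : X ≃ᵢ X)
    (hg : CatZero.IsUnbounded x₀ g) (hh : CatZero.IsUnbounded x₀ h)
    (ξm ξp ηm ηp : CatZero.Boundary X)
    (hξ : CatZero.HasLimitPoints x₀ g ξm ξp) (hη : CatZero.HasLimitPoints x₀ h ηm ηp)
    (hT : ENNReal.ofReal Real.pi < CatZero.titsSetDist {ξm, ξp} {ηm, ηp}) :
    ∃ H : Subgroup (X ≃ᵢ X), H ≤ Subgroup.closure {g, h} ∧ IsFreeGroup H ∧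
      ∃ a ∈ H, ∃ b ∈ H, a * b ≠ b * a := by
  let := CatZero.isometryAction X
  choose c hc hcξ using fun i : Bool => hX.exists_ray x₀ (cond i ξp ξm)
  choose d hd hdη using fun i : Bool => hX.exists_ray x₀ (cond i ηp ηm)
  have hTij : ∀ i j, ENNReal.ofReal Real.pi < CatZero.titsDist (c i).endpoint (d j).endpoint := by
    intro i j
    refine hT.trans_le ((iInf₂_le (c i).endpoint ?_).trans (iInf₂_le (d j).endpoint ?_))
    · rw [hcξ]; cases i <;> simp
    · rw [hdη]; cases j <;> simp
  obtain ⟨R, hR, hnear⟩ := hX.exists_geodesicsNear hc hd hTij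
  obtain ⟨r, hRr, hmaps⟩ := hX.exists_biMoves_mapsTo (p := x₀) hR
  have hU := hmaps c hc _ hnear
  have hV := hmaps d hd _ hnear.symm
  obtain ⟨a, ha, a', ha', haU, haU', haa⟩ := hX.exists_biMoves_powers (c := c) (p := x₀) (g := g)
    (by rw [hcξ, hcξ]; exact hξ) (hR.trans hRr)
  obtain ⟨b, hb, b', hb', hbV, hbV', hbb⟩ := hX.exists_biMoves_powers (c := d) (p := x₀) (g := h)
    (by rw [hdη, hdη]; exact hη) (hR.trans hRr)
  have hle : ∀ f ∈ ({g, h} : Set (X ≃ᵢ X)), Subgroup.zpowers f ≤ Subgroup.closure {g, h} :=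
    fun f hf => (Subgroup.zpowers_le).2 (Subgroup.subset_closure hf)
  -- One quotient suffices for both orders, since `biMoves` is closed under inverses.
  have hdiff : ∀ {S : Set X} {u v : X ≃ᵢ X}, u⁻¹ * v ∈ CatZero.biMoves x₀ S →
      ∀ i j, i ≠ j → (cond i v u)⁻¹ * cond j v u ∈ CatZero.biMoves x₀ S := by
    rintro S u v huv (_ | _) (_ | _) hij
    · exact (hij rfl).elim
    · exact huv
    · simpa using CatZero.inv_mem_biMoves huv
    · exact (hij rfl).elim
  have hcond : ∀ {S : Set X} {u v : X ≃ᵢ X}, u ∈ CatZero.biMoves x₀ S →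
      v ∈ CatZero.biMoves x₀ S → ∀ i, cond i v u ∈ CatZero.biMoves x₀ S := by
    rintro S u v hu hv (_ | _)
    exacts [hu, hv]
  refine CatZero.exists_isFreeGroup_of_injective_lift
    (a := fun i => cond i a' a * (cond i b' b)⁻¹) ?_
    (CatZero.injective_lift_of_smul_mem (CatZero.disjoint_visualNhds hc hnear)
      ⟨_, hX.visualNhds_anti c hRr haU.1⟩ ⟨_, hX.visualNhds_anti d hRr hbV.1⟩
      (fun i => hU _ (hcond haU haU' i))
      (fun i => hU _ (CatZero.inv_mem_biMoves (hcond haU haU' i)))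
      (fun i j hij => hU _ (hdiff haa i j hij))
      (fun i => hV _ (hcond hbV hbV' i))
      (fun i => hV _ (CatZero.inv_mem_biMoves (hcond hbV hbV' i)))
      (fun i j hij => hV _ (hdiff hbb i j hij)))
  rintro (_ | _)
  · exact mul_mem (hle g (by simp) ha) (inv_mem (hle h (by simp) hb))
  · exact mul_mem (hle g (by simp) ha') (inv_mem (hle h (by simp) hb'))
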